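/- A $k$-coloring of a digraph is a map from its vertices to $\{1,\dots,k\}$ such that no color class contains all the vertices of a directed cycle; the dichromatic number of a digraph is the least $k$ for which it has a $k$-coloring. Up to isomorphism there are exactly $6880$ tournaments on $8$ vertices, and among them exactly $64$ have dichromatic number $3$ and contain none of Neumann-Lara's $7$-vertex $3$-dichromatic tournaments, that is, contain no tournament on $7$ vertices with dichromatic number $3$ as a subdigraph. -/

import Mathlib

namespace Dicolor

/-- A tournament: no loops, and between any two distinct vertices exactly one of the two
possible arcs is present. -/
def IsTournament {V : Type*} (D : Digraph V) : Prop :=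
  (∀ v, ¬ D.Adj v v) ∧ ∀ u v, u ≠ v → Xor (D.Adj u v) (D.Adj v u)

/-- The vertices `c 0, c 1, …, c n` are pairwise distinct and
`c 0 → c 1 → ⋯ → c n → c 0` is a directed cycle (circuit) of length `n + 1` in `D`;
the addition in `Fin (n + 1)` is cyclic. -/
def IsCircuit {V : Type*} (D : Digraph V) {n : ℕ} (c : Fin (n + 1) → V) : Prop :=
  Function.Injective c ∧ ∀ i, D.Adj (c i) (c (i + 1))

/-- The set `S` of vertices is acyclic in `D`: no circuit of `D` has all its vertices in `S`. -/
def IsAcyclicOn {V : Type*} (D : Digraph V) (S : Set V) : Prop :=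
  ∀ (n : ℕ) (c : Fin (n + 1) → V), IsCircuit D c → ¬ ∀ i, c i ∈ S

/-- A `k`-coloring of `D`: every color class is acyclic. -/
def IsDicoloring {V : Type*} (D : Digraph V) {k : ℕ} (f : V → Fin k) : Prop :=
  ∀ j : Fin k, IsAcyclicOn D {v | f v = j}

/-- The dichromatic number: the least `k` such that `D` has a `k`-coloring
(`⊤` if there is no such `k`). -/
noncomputable def dichromaticNumber {V : Type*} (D : Digraph V) : ℕ∞ :=
  ⨅ k ∈ {k : ℕ | ∃ f : V → Fin k, IsDicoloring D f}, (k : ℕ∞)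

/-- `D` contains `H`: some injective map of the vertices sends arcs of `H` to arcs of `D`. -/
def Contains {V W : Type*} (D : Digraph V) (H : Digraph W) : Prop :=
  ∃ f : W ↪ V, ∀ a b, H.Adj a b → D.Adj (f a) (f b)

/-- Labelled tournaments on `n` vertices. -/
abbrev Tournament (n : ℕ) : Type := {D : Digraph (Fin n) // IsTournament D}

/-- Isomorphism of tournaments on `n` vertices. -/
instance tournamentSetoid (n : ℕ) : Setoid (Tournament n) where
  r S T := Nonempty (S.1.Adj ≃r T.1.Adj)
  iseqv :=
    { refl := fun S => ⟨RelIso.refl S.1.Adj⟩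
      symm := fun ⟨e⟩ => ⟨e.symm⟩
      trans := fun ⟨e⟩ ⟨e'⟩ => ⟨e.trans e'⟩ }

/-- Tournaments on `n` vertices up to isomorphism. -/
abbrev TournamentClass (n : ℕ) : Type := Quotient (tournamentSetoid n)

end Dicolor

/-!
Both numbers come from the orbit-counting lemma for the symmetric group on the eight labels: the
number of isomorphism classes of tournaments with an invariant property `P`, times `8!`, is the sum
over all permutations `g` of the number of labelled tournaments with `P` that are fixed by `g`
(`ncard_classes_mul_factorial`). A permutation with a cycle of even length fixes no tournament,
because one of its powers exchanges two vertices. The remaining cycle types are those with cycles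
of lengths `1, 3, 5, 7`; there are six of them, and the number of fixed tournaments depends on the
type only (`sum_countTournaments_fixed`).

For the second number the property `P` is criticality: the tournament has no `2`-coloring, but
acquires one as soon as a vertex is deleted. This is equivalent to having dichromatic number `3`
without containing a `3`-dichromatic tournament on seven vertices (`isCritical_iff`). Since a set of
vertices of a tournament is acyclic as soon as it contains no directed triangle
(`isAcyclicOn_iff_triFree`), criticality is a Boolean expression in the `28` arcs.

The tournaments fixed by a permutation `g` are parametrized by free binary parameters, one for each
orbit of `g` on the pairs of vertices. A Boolean function of `m` parameters is stored as a natural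
number with `2 ^ m` binary digits, its truth table; the connectives then are bitwise operations on
large numbers, and the kernel evaluates the table of criticality for all values of the parameters
at once (`testBit_criticalTable`) and counts its ones (`popcount_eq`). For the identity permutation
the `28` parameters are reduced to `21` by prescribing the out-neighbourhood of the vertex `0`: by
symmetry only its size `d` matters, so the number of labelled critical tournaments is the sum of
`Nat.choose 7 d` times the number of those with out-neighbourhood `{1, …, d}`
(`countTournaments_isCritical`).
-/

namespace Dicolor

/-! ### Acyclic sets, 2-colorings and critical tournaments -/

/-- No directed triangle of `D` has its three vertices in `S`. -/
def TriFree {V : Type*} (D : Digraph V) (S : Set V) : Prop :=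
  ∀ u ∈ S, ∀ v ∈ S, ∀ w ∈ S, D.Adj u v → D.Adj v w → ¬ D.Adj w u

theorem IsTournament.asymm {V : Type*} {D : Digraph V} (hD : IsTournament D) {u v : V}
    (h : D.Adj u v) : ¬ D.Adj v u := by
  intro h'
  have huv : u ≠ v := fun e => hD.1 v (by rwa [e] at h)
  rcases hD.2 u v huv with ⟨_, h2⟩ | ⟨_, h2⟩
  exacts [h2 h', h2 h]

theorem IsTournament.not_adj_iff {V : Type*} {D : Digraph V} (hD : IsTournament D) {u v : V}
    (huv : u ≠ v) : ¬ D.Adj u v ↔ D.Adj v u := by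
  refine ⟨fun h => ?_, fun h => hD.asymm h⟩
  rcases hD.2 u v huv with ⟨h1, _⟩ | ⟨h1, _⟩
  exacts [absurd h1 h, h1]

theorem TriFree.mono {V : Type*} {D : Digraph V} {S S' : Set V} (h : TriFree D S')
    (hS : S ⊆ S') : TriFree D S :=
  fun u hu v hv w hw => h u (hS hu) v (hS hv) w (hS hw)

/-- In a tournament a triangle-free set carries a transitive relation, so a circuit inside it
would make its first vertex dominate all the others and, finally, itself. -/
theorem isAcyclicOn_iff_triFree {V : Type*} {D : Digraph V} (hD : IsTournament D) (S : Set V) :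
    IsAcyclicOn D S ↔ TriFree D S := by
  constructor
  · intro h u hu v hv w hw huv hvw hwu
    have ne : ∀ {a b : V}, D.Adj a b → a ≠ b := fun {a b} hab e => hD.1 b (by rwa [e] at hab)
    refine h 2 ![u, v, w] ⟨?_, ?_⟩ ?_
    · intro i j hij
      have h1 := ne huv
      have h2 := ne hvw
      have h3 := ne hwu
      fin_cases i <;> fin_cases j <;> simp at hij ⊢ <;> simp_all
    · intro i
      fin_cases i
      exacts [huv, hvw, hwu]
    · intro i
      fin_cases i
      exacts [hu, hv, hw]
  · intro h n c hc hS
    have key : ∀ k : ℕ, D.Adj (c 0) (c (Fin.ofNat (n + 1) (k + 1))) := by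
      intro k
      induction k with
      | zero =>
        have h1 : Fin.ofNat (n + 1) (0 + 1) = 0 + 1 := by ext; simp
        rw [h1]
        exact hc.2 0
      | succ k ih =>
        have h1 := hc.2 (Fin.ofNat (n + 1) (k + 1))
        have h2 : ((Fin.ofNat (n + 1) (k + 1)) + 1) = (Fin.ofNat (n + 1) (k + 1 + 1)) := by
          ext; simp [Fin.val_add]
        rw [h2] at h1
        have h3 := h _ (hS 0) _ (hS _) _ (hS _) ih h1
        by_cases e : c 0 = c (Fin.ofNat (n + 1) (k + 1 + 1))
        · rw [← e] at h1
          exact absurd h1 (hD.asymm ih)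
        · exact (hD.not_adj_iff (Ne.symm e)).1 h3
    have h0 := key n
    have h1 : Fin.ofNat (n + 1) (n + 1) = 0 := by ext; simp
    rw [h1] at h0
    exact hD.1 _ h0

/-- The vertex set `U` is covered by two triangle-free sets. In a tournament this says that
the subtournament on `U` has a `2`-coloring. -/
def TwoCol {V : Type*} (D : Digraph V) (U : Set V) : Prop :=
  ∃ X Y : Set V, TriFree D X ∧ TriFree D Y ∧ ∀ v ∈ U, v ∈ X ∨ v ∈ Y

/-- `D` is not `2`-colorable, but becomes so when any one vertex is deleted. -/
def IsCritical {V : Type*} (D : Digraph V) : Prop :=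
  (∀ v, TwoCol D {v}ᶜ) ∧ ¬ TwoCol D Set.univ

theorem TriFree.preimage {V W : Type*} {D : Digraph V} {E : Digraph W} {S : Set W}
    (h : TriFree E S) {f : V → W} (hf : ∀ u v, D.Adj u v → E.Adj (f u) (f v)) :
    TriFree D (f ⁻¹' S) :=
  fun _ hu _ hv _ hw h1 h2 h3 => h _ hu _ hv _ hw (hf _ _ h1) (hf _ _ h2) (hf _ _ h3)

theorem TwoCol.preimage {V W : Type*} {D : Digraph V} {E : Digraph W} {U : Set W}
    (h : TwoCol E U) {f : V → W} (hf : ∀ u v, D.Adj u v → E.Adj (f u) (f v)) :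
    TwoCol D (f ⁻¹' U) := by
  obtain ⟨X, Y, hX, hY, hU⟩ := h
  exact ⟨_, _, hX.preimage hf, hY.preimage hf, fun v hv => hU _ hv⟩

theorem twoCol_iff_exists_isDicoloring {V : Type*} {D : Digraph V} (hD : IsTournament D) :
    TwoCol D Set.univ ↔ ∃ f : V → Fin 2, IsDicoloring D f := by
  classical
  constructor
  · rintro ⟨X, Y, hX, hY, h⟩
    refine ⟨fun v => if v ∈ X then 0 else 1, fun j => ?_⟩
    rw [isAcyclicOn_iff_triFree hD]
    fin_cases j
    · refine hX.mono fun v hv => ?_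
      by_contra hvX
      simp [hvX] at hv
    · refine hY.mono fun v hv => (h v trivial).resolve_left fun hvX => ?_
      simp [hvX] at hv
  · rintro ⟨f, hf⟩
    refine ⟨{v | f v = 0}, {v | f v = 1}, (isAcyclicOn_iff_triFree hD _).1 (hf 0),
      (isAcyclicOn_iff_triFree hD _).1 (hf 1), fun v _ => ?_⟩
    rcases Fin.exists_fin_two.1 ⟨f v, rfl⟩ with h | h
    exacts [Or.inl h, Or.inr h]

theorem IsDicoloring.succ {V : Type*} {D : Digraph V} {k : ℕ} {f : V → Fin k}
    (h : IsDicoloring D f) : IsDicoloring D (fun v => (f v).castSucc) := by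
  intro j n c hc hS
  obtain ⟨i, hi⟩ : ∃ i : Fin k, i.castSucc = j := ⟨_, hS 0⟩
  refine h i n c hc fun a => ?_
  have := hS a
  rw [← hi] at this
  exact Fin.castSucc_injective _ this

theorem dichromaticNumber_le_iff {V : Type*} {D : Digraph V} {k : ℕ} :
    dichromaticNumber D ≤ k ↔ ∃ f : V → Fin k, IsDicoloring D f := by
  constructor
  · intro h
    have hlt : dichromaticNumber D < ((k + 1 : ℕ) : ℕ∞) :=
      lt_of_le_of_lt h (by exact_mod_cast Nat.lt_succ_self k)
    simp only [dichromaticNumber, iInf_lt_iff] at hlt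
    obtain ⟨i, hi, hik⟩ := hlt
    have hle : i ≤ k := Nat.lt_succ_iff.1 (by exact_mod_cast hik)
    clear h hik
    induction hle with
    | refl => exact hi
    | step _ ih =>
      obtain ⟨f, hf⟩ := ih
      exact ⟨_, hf.succ⟩
  · intro h
    exact iInf₂_le k h

theorem dichromaticNumber_eq_three_iff {V : Type*} {D : Digraph V} :
    dichromaticNumber D = 3 ↔
      (∃ f : V → Fin 3, IsDicoloring D f) ∧ ¬ ∃ f : V → Fin 2, IsDicoloring D f := by
  rw [← dichromaticNumber_le_iff, ← dichromaticNumber_le_iff, not_le, Nat.cast_ofNat,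
    Nat.cast_ofNat]
  constructor
  · intro h
    rw [h]
    exact ⟨le_rfl, by decide⟩
  · rintro ⟨h1, h2⟩
    refine le_antisymm h1 ?_
    have := Order.add_one_le_of_lt h2
    exact this

theorem IsTournament.comap {V W : Type*} {D : Digraph V} (hD : IsTournament D) (f : W ↪ V) :
    IsTournament (⟨fun a b => D.Adj (f a) (f b)⟩ : Digraph W) :=
  ⟨fun _ => hD.1 _, fun _ _ hab => hD.2 _ _ (f.injective.ne hab)⟩

/-- A tournament on `n + 1` vertices that has dichromatic number `3` and contains no
`3`-dichromatic tournament on `n` vertices is the same as a critical one: deleting a vertex leaves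
a tournament on `n` vertices, and the deleted vertex alone can serve as a third color class. -/
theorem isCritical_iff {n : ℕ} (T : Tournament (n + 1)) :
    (dichromaticNumber T.1 = 3 ∧ ∀ H : Tournament n, dichromaticNumber H.1 = 3 →
      ¬ Contains T.1 H.1) ↔ IsCritical T.1 := by
  obtain ⟨D, hD⟩ := T
  dsimp only
  rw [dichromaticNumber_eq_three_iff, ← twoCol_iff_exists_isDicoloring hD]
  constructor
  · rintro ⟨⟨⟨f, hf⟩, h2⟩, hH⟩
    refine ⟨fun v => ?_, h2⟩
    by_contra hv
    have hE := hD.comap v.succAboveEmb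
    refine hH ⟨_, hE⟩ ?_ ⟨v.succAboveEmb, fun a b h => h⟩
    rw [dichromaticNumber_eq_three_iff, ← twoCol_iff_exists_isDicoloring hE]
    refine ⟨⟨fun a => f (v.succAboveEmb a), fun j => ?_⟩, ?_⟩
    · rw [isAcyclicOn_iff_triFree hE]
      have := (isAcyclicOn_iff_triFree hD _).1 (hf j)
      exact fun a ha b hb c hc => this _ ha _ hb _ hc
    · rintro ⟨X, Y, hX, hY, h⟩
      refine hv ⟨v.succAbove '' X, v.succAbove '' Y, ?_, ?_, fun w hw => ?_⟩
      · rintro _ ⟨a, ha, rfl⟩ _ ⟨b, hb, rfl⟩ _ ⟨c, hc, rfl⟩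
        exact hX a ha b hb c hc
      · rintro _ ⟨a, ha, rfl⟩ _ ⟨b, hb, rfl⟩ _ ⟨c, hc, rfl⟩
        exact hY a ha b hb c hc
      · obtain ⟨a, rfl⟩ := Fin.exists_succAbove_eq hw
        exact (h a trivial).imp (Set.mem_image_of_mem _) (Set.mem_image_of_mem _)
  · rintro ⟨h1, h2⟩
    refine ⟨⟨?_, h2⟩, ?_⟩
    · obtain ⟨X, Y, hX, hY, h⟩ := h1 0
      classical
      refine ⟨fun v => if v = 0 then 2 else if v ∈ X then 0 else 1, fun j => ?_⟩
      rw [isAcyclicOn_iff_triFree hD]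
      fin_cases j
      · refine hX.mono fun v hv => ?_
        by_contra hvX
        by_cases h0 : v = 0 <;> simp [hvX, h0] at hv
      · refine hY.mono fun v hv => ?_
        by_cases h0 : v = 0
        · simp [h0] at hv
        · refine (h v h0).resolve_left fun hvX => ?_
          simp [hvX, h0] at hv
      · have h0 : ∀ v : Fin (n + 1), (if v = 0 then (2 : Fin 3) else if v ∈ X then 0 else 1) = 2 →
            v = 0 := by
          intro v hv
          by_contra h0
          by_cases hvX : v ∈ X <;> simp [h0, hvX] at hv
        intro u hu v hv w hw huv
        rw [h0 u hu, h0 v hv] at huv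
        exact absurd huv (hD.1 0)
    · rintro ⟨H, hH⟩ h3 ⟨f, hf⟩
      dsimp only at h3 hf
      rw [dichromaticNumber_eq_three_iff, ← twoCol_iff_exists_isDicoloring hH] at h3
      obtain ⟨v, hv⟩ : ∃ v, ∀ a, f a ≠ v := by
        by_contra hc
        push Not at hc
        have := Fintype.card_le_of_surjective f hc
        simp at this
      obtain ⟨X, Y, hX, hY, h⟩ := h1 v
      exact h3.2 ⟨f ⁻¹' X, f ⁻¹' Y,
        fun a ha b hb c hc h1 h2 h3 => hX _ ha _ hb _ hc (hf _ _ h1) (hf _ _ h2) (hf _ _ h3),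
        fun a ha b hb c hc h1 h2 h3 => hY _ ha _ hb _ hc (hf _ _ h1) (hf _ _ h2) (hf _ _ h3),
        fun a _ => h (f a) (hv a)⟩

/-! ### Truth tables and the number of their ones -/

/-- The table, over the codes below `2 ^ m`, of the `k`-th binary digit. -/
def varTable (k : ℕ) : ℕ → ℕ
  | 0 => 0
  | m + 1 => bif Nat.beq m k then (2 ^ 2 ^ m - 1) <<< 2 ^ m
      else varTable k m ||| varTable k m <<< 2 ^ m

theorem varTable_lt (k m : ℕ) : varTable k m < 2 ^ 2 ^ m := by
  induction m with
  | zero => simp [varTable]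
  | succ m ih =>
    have h2 : 2 ^ (m + 1) = 2 ^ m + 2 ^ m := by ring
    rw [h2]
    unfold varTable
    cases Nat.beq m k
    · refine Nat.or_lt_two_pow (ih.trans_le (Nat.pow_le_pow_right two_pos (Nat.le_add_left _ _))) ?_
      rw [Nat.shiftLeft_eq, pow_add]
      exact Nat.mul_lt_mul_of_pos_right ih (by positivity)
    · simp only [cond_true]
      rw [Nat.shiftLeft_eq, pow_add]
      exact Nat.mul_lt_mul_of_pos_right (Nat.sub_lt (by positivity) one_pos) (by positivity)

theorem testBit_varTable {k m x : ℕ} (hk : k < m) (hx : x < 2 ^ m) :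
    (varTable k m).testBit x = x.testBit k := by
  induction m generalizing x with
  | zero => omega
  | succ m ih =>
    have h2 : 2 ^ (m + 1) = 2 ^ m + 2 ^ m := by ring
    unfold varTable
    by_cases hmk : m = k
    · subst hmk
      simp only [cond_true, Nat.testBit_shiftLeft, Nat.testBit_two_pow_sub_one, Nat.beq_refl]
      by_cases hxm : 2 ^ m ≤ x
      · obtain ⟨y, rfl⟩ := Nat.exists_eq_add_of_le hxm
        rw [Nat.testBit_two_pow_add_eq, Nat.testBit_lt_two_pow (by omega)]
        simp; omega
      · rw [Nat.testBit_lt_two_pow (by omega)]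
        simp; omega
    · have : Nat.beq m k = false := by
        rw [Bool.eq_false_iff]; intro h; exact hmk (Nat.eq_of_beq_eq_true h)
      simp only [this, cond_false, Nat.testBit_or, Nat.testBit_shiftLeft]
      by_cases hxm : 2 ^ m ≤ x
      · obtain ⟨y, rfl⟩ := Nat.exists_eq_add_of_le hxm
        rw [Nat.testBit_lt_two_pow ((varTable_lt k m).trans_le (Nat.pow_le_pow_right two_pos hxm)),
          Nat.testBit_two_pow_add_gt (by omega)]
        simp [ih (by omega : k < m) (by omega : y < 2 ^ m)]
      · rw [ih (by omega) (by omega)]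
        simp [hxm]

section Tables

variable {V : Type*} (A : V → V → ℕ) (o : ℕ)

/- The lists below are only ever extended at their heads by entries of a fixed list, so the same
sublists recur as syntactically equal closed terms, and the table of each is evaluated once. -/

/-- Table of: `u, v, w` do not form a directed triangle. -/
def triTable (u v w : V) : ℕ :=
  o ^^^ ((A u v &&& A v w &&& A w u) ||| (A u w &&& A w v &&& A v u))

/-- Table of: no directed triangle consists of `u`, `v` and a vertex of the list. -/
def edgeTable (u v : V) : List V → ℕ
  | [] => o
  | w :: l => edgeTable u v l &&& triTable A o u v w

/-- Table of: no directed triangle consists of `u` and two vertices of the list. -/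
def linkTable (u : V) : List V → ℕ
  | [] => o
  | v :: l => linkTable u l &&& edgeTable A o u v l

/-- Table of: the list contains no directed triangle. -/
def acyclicTable : List V → ℕ
  | [] => o
  | u :: l => acyclicTable l &&& linkTable A o u l

/-- Table of: the vertices of the first list can be distributed over the two others so that neither
contains a directed triangle. -/
def twoColTable : List V → List V → List V → ℕ
  | [], a, b => acyclicTable A o a &&& acyclicTable A o b
  | v :: l, a, b => twoColTable l (v :: a) b ||| twoColTable l a (v :: b)

/-- Table of: the list is covered by two lists without directed triangle. By symmetry its first
vertex may be put into the first of them. -/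
def coverTable : List V → ℕ
  | [] => o
  | v :: l => twoColTable A o l [v] []

/-- Table of: for every vertex `v` of the second list, the first list without `v` is covered by two
lists without directed triangle. -/
def deleteTable [BEq V] (all : List V) : List V → ℕ
  | [] => o
  | v :: l => coverTable A o (all.filter (· != v)) &&& deleteTable all l

/-- Table of criticality of the digraph on the listed vertices whose arcs have the tables `A`;
`o` is the table of the constant `true`. -/
def criticalTable [BEq V] (all : List V) : ℕ :=
  deleteTable A o all all &&& (o ^^^ coverTable A o all)

variable {A o}

/-- `u, v, w` is not a directed triangle of `D`, in either direction. -/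
def NoTri (D : Digraph V) (u v w : V) : Prop :=
  ¬ (D.Adj u v ∧ D.Adj v w ∧ D.Adj w u) ∧ ¬ (D.Adj u w ∧ D.Adj w v ∧ D.Adj v u)

theorem NoTri.rotate {D : Digraph V} {u v w : V} (h : NoTri D u v w) : NoTri D v w u :=
  ⟨fun h' => h.1 ⟨h'.2.2, h'.1, h'.2.1⟩, fun h' => h.2 ⟨h'.2.1, h'.2.2, h'.1⟩⟩

theorem NoTri.swap {D : Digraph V} {u v w : V} (h : NoTri D u v w) : NoTri D u w v :=
  ⟨h.2, h.1⟩

theorem NoTri.of_eq {D : Digraph V} (hD : IsTournament D) (u v : V) : NoTri D u v v :=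
  ⟨fun h => hD.1 v h.2.1, fun h => hD.1 v h.2.1⟩

theorem testBit_triTable {x : ℕ} (ho : o.testBit x = true) {D : Digraph V}
    (hA : ∀ u v, (A u v).testBit x = true ↔ D.Adj u v) (u v w : V) :
    (triTable A o u v w).testBit x = true ↔ NoTri D u v w := by
  simp only [triTable, NoTri, Nat.testBit_xor, Nat.testBit_or, Nat.testBit_and, ho, ← hA]
  simp [imp_iff_not_or, or_assoc]

theorem testBit_edgeTable {x : ℕ} (ho : o.testBit x = true) {D : Digraph V}
    (hA : ∀ u v, (A u v).testBit x = true ↔ D.Adj u v) (u v : V) (l : List V) :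
    (edgeTable A o u v l).testBit x = true ↔ ∀ w ∈ l, NoTri D u v w := by
  induction l with
  | nil => simp [edgeTable, ho]
  | cons w l ih =>
    simp [edgeTable, Nat.testBit_and, ih, testBit_triTable ho hA, and_comm]

theorem testBit_linkTable {x : ℕ} (ho : o.testBit x = true) {D : Digraph V}
    (hD : IsTournament D) (hA : ∀ u v, (A u v).testBit x = true ↔ D.Adj u v) (u : V) (l : List V) :
    (linkTable A o u l).testBit x = true ↔ ∀ v ∈ l, ∀ w ∈ l, NoTri D u v w := by
  induction l with
  | nil => simp [linkTable, ho]
  | cons v l ih =>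
    rw [linkTable, Nat.testBit_and, Bool.and_eq_true, ih, testBit_edgeTable ho hA]
    simp only [List.forall_mem_cons]
    exact ⟨fun h => ⟨⟨NoTri.of_eq hD u v, h.2⟩, fun w hw => ⟨(h.2 w hw).swap, h.1 w hw⟩⟩,
      fun h => ⟨fun w hw => (h.2 w hw).2, h.1.2⟩⟩

theorem testBit_acyclicTable {x : ℕ} (ho : o.testBit x = true) {D : Digraph V}
    (hD : IsTournament D) (hA : ∀ u v, (A u v).testBit x = true ↔ D.Adj u v) (l : List V) :
    (acyclicTable A o l).testBit x = true ↔ TriFree D {v | v ∈ l} := by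
  have key : TriFree D {v | v ∈ l} ↔ ∀ u ∈ l, ∀ v ∈ l, ∀ w ∈ l, NoTri D u v w :=
    ⟨fun h u hu v hv w hw => ⟨fun h' => h u hu v hv w hw h'.1 h'.2.1 h'.2.2,
      fun h' => h u hu w hw v hv h'.1 h'.2.1 h'.2.2⟩,
      fun h u hu v hv w hw h1 h2 h3 => (h u hu v hv w hw).1 ⟨h1, h2, h3⟩⟩
  rw [key]
  clear key
  induction l with
  | nil => simp [acyclicTable, ho]
  | cons u l ih =>
    rw [acyclicTable, Nat.testBit_and, Bool.and_eq_true, testBit_linkTable ho hD hA]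
    refine (and_congr_left' ih).trans ?_
    simp only [List.forall_mem_cons]
    have e1 := fun v => (NoTri.of_eq hD v u)
    constructor
    · rintro ⟨h1, h2⟩
      exact ⟨⟨⟨e1 u, fun w _ => (e1 w).rotate⟩,
        fun v hv => ⟨(e1 v).rotate.rotate, h2 v hv⟩⟩,
        fun v hv => ⟨⟨e1 v, fun w hw => (h2 w hw v hv).rotate.rotate⟩,
          fun w hw => ⟨(h2 v hv w hw).rotate, h1 v hv w hw⟩⟩⟩
    · rintro ⟨⟨-, h2⟩, h3⟩
      exact ⟨fun v hv w hw => ((h3 v hv).2 w hw).2, fun v hv => (h2 v hv).2⟩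

theorem testBit_twoColTable {x : ℕ} (ho : o.testBit x = true) {D : Digraph V}
    (hD : IsTournament D) (hA : ∀ u v, (A u v).testBit x = true ↔ D.Adj u v) (l a b : List V) :
    (twoColTable A o l a b).testBit x = true ↔ ∃ X Y : Set V, TriFree D X ∧ TriFree D Y ∧
      (∀ v ∈ a, v ∈ X) ∧ (∀ v ∈ b, v ∈ Y) ∧ ∀ v ∈ l, v ∈ X ∨ v ∈ Y := by
  induction l generalizing a b with
  | nil =>
    rw [twoColTable, Nat.testBit_and, Bool.and_eq_true, testBit_acyclicTable ho hD hA,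
      testBit_acyclicTable ho hD hA]
    exact ⟨fun h => ⟨_, _, h.1, h.2, fun _ h => h, fun _ h => h, by simp⟩,
      fun ⟨X, Y, hX, hY, ha, hb, _⟩ => ⟨hX.mono ha, hY.mono hb⟩⟩
  | cons v l ih =>
    rw [twoColTable, Nat.testBit_or, Bool.or_eq_true, ih, ih]
    simp only [List.forall_mem_cons]
    constructor
    · rintro (⟨X, Y, hX, hY, ha, hb, h⟩ | ⟨X, Y, hX, hY, ha, hb, h⟩)
      exacts [⟨X, Y, hX, hY, ha.2, hb, Or.inl ha.1, h⟩, ⟨X, Y, hX, hY, ha, hb.2, Or.inr hb.1, h⟩]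
    · rintro ⟨X, Y, hX, hY, ha, hb, hv | hv, h⟩
      exacts [Or.inl ⟨X, Y, hX, hY, ⟨hv, ha⟩, hb, h⟩, Or.inr ⟨X, Y, hX, hY, ha, ⟨hv, hb⟩, h⟩]

theorem testBit_coverTable {x : ℕ} (ho : o.testBit x = true) {D : Digraph V}
    (hD : IsTournament D) (hA : ∀ u v, (A u v).testBit x = true ↔ D.Adj u v) (l : List V) :
    (coverTable A o l).testBit x = true ↔ TwoCol D {v | v ∈ l} := by
  cases l with
  | nil => simpa [coverTable, ho] using ⟨∅, ∅, by simp [TriFree], by simp [TriFree], by simp⟩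
  | cons v l =>
    rw [coverTable, testBit_twoColTable ho hD hA]
    simp only [List.forall_mem_singleton, List.not_mem_nil, false_imp_iff, implies_true, true_and,
      TwoCol, Set.mem_ofPred_eq, List.forall_mem_cons]
    constructor
    · rintro ⟨X, Y, hX, hY, hv, h⟩
      exact ⟨X, Y, hX, hY, Or.inl hv, h⟩
    · rintro ⟨X, Y, hX, hY, hv | hv, h⟩
      exacts [⟨X, Y, hX, hY, hv, h⟩, ⟨Y, X, hY, hX, hv, fun w hw => (h w hw).symm⟩]

theorem testBit_criticalTable [BEq V] [LawfulBEq V] {x : ℕ} (ho : o.testBit x = true)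
    {D : Digraph V} (hD : IsTournament D) (hA : ∀ u v, (A u v).testBit x = true ↔ D.Adj u v)
    {all : List V} (hall : ∀ v, v ∈ all) :
    (criticalTable A o all).testBit x = true ↔ IsCritical D := by
  have hdel : ∀ l : List V, (deleteTable A o all l).testBit x = true ↔
      ∀ v ∈ l, TwoCol D {v}ᶜ := by
    intro l
    induction l with
    | nil => simp [deleteTable, ho]
    | cons v l ih =>
      rw [deleteTable, Nat.testBit_and, Bool.and_eq_true, ih, testBit_coverTable ho hD hA]
      simp [hall, ← Set.compl_singleton_eq]
  rw [criticalTable, Nat.testBit_and, Bool.and_eq_true, hdel, Nat.testBit_xor, ho, Bool.true_xor,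
    Bool.not_eq_true', ← Bool.not_eq_true, testBit_coverTable ho hD hA]
  simp [IsCritical, hall]

end Tables

/-- The number of ones among the `w * n` lowest binary digits of `t`, for `n < 2 ^ w - 1`.
For every `r < w`, the digits at the positions `r, w + r, 2 * w + r, …` are masked out as digits
in base `2 ^ w` and added up by a reduction modulo `2 ^ w - 1`. -/
def popcount (w n t : ℕ) : ℕ :=
  ((List.range w).map fun r =>
    ((t >>> r) &&& ((2 ^ (w * n) - 1) / (2 ^ w - 1))) % (2 ^ w - 1)).sum

theorem popcount_eq {w n : ℕ} (hn : n < 2 ^ w - 1) (t : ℕ) :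
    popcount w n t = ((Finset.range (w * n)).filter fun x => t.testBit x = true).card := by
  have hw : 2 ^ w - 1 + 1 = 2 ^ w := Nat.sub_add_cancel Nat.one_le_two_pow
  -- the mask with a one at each of the positions `0, w, 2 * w, …`
  have hmask : ∀ n, (2 ^ (w * (n + 1)) - 1) / (2 ^ w - 1) =
      1 + 2 ^ w * ((2 ^ (w * n) - 1) / (2 ^ w - 1)) := by
    intro n
    have h1 : (2 ^ w - 1) ∣ 2 ^ (w * n) - 1 := by
      rw [pow_mul]; simpa using Nat.sub_dvd_pow_sub_pow (2 ^ w) 1 n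
    obtain ⟨q, hq⟩ := h1
    have h2 : 2 ^ (w * (n + 1)) - 1 = (2 ^ w - 1) * (1 + 2 ^ w * q) := by
      have h3 : 2 ^ (w * n) = (2 ^ w - 1) * q + 1 := by
        have := Nat.one_le_two_pow (n := w * n); omega
      rw [mul_add, pow_add, h3, mul_one, ← hw]
      simp only [Nat.add_sub_cancel]
      have : ((2 ^ w - 1) * q + 1) * (2 ^ w - 1 + 1) =
        (2 ^ w - 1) * (1 + (2 ^ w - 1 + 1) * q) + 1 := by ring
      omega
    rw [h2, hq, Nat.mul_div_cancel_left _ (by omega), Nat.mul_div_cancel_left _ (by omega)]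
  have hw0 : 0 < w := by
    rcases Nat.eq_zero_or_pos w with rfl | h
    · simp at hn
    · exact h
  -- since `2 ^ w` is `1` modulo `2 ^ w - 1`, the masked number is congruent to its digit sum
  have hfold : ∀ n t, (t &&& ((2 ^ (w * n) - 1) / (2 ^ w - 1))) ≡
      ∑ i ∈ Finset.range n, (t.testBit (w * i)).toNat [MOD 2 ^ w - 1] := by
    intro n
    induction n with
    | zero => intro t; simp; rfl
    | succ n ih =>
      intro t
      have h1 : t &&& ((2 ^ (w * (n + 1)) - 1) / (2 ^ w - 1)) = (t.testBit 0).toNat +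
          2 ^ w * ((t >>> w) &&& ((2 ^ (w * n) - 1) / (2 ^ w - 1))) := by
        have hb : (t.testBit 0).toNat < 2 ^ w :=
          lt_of_lt_of_le (Bool.toNat_lt _) (by simpa using Nat.pow_le_pow_right two_pos hw0)
        have h1w : 1 < 2 ^ w := Nat.one_lt_two_pow hw0.ne'
        rw [hmask]
        refine Nat.eq_of_testBit_eq fun i => ?_
        rw [add_comm 1, add_comm (t.testBit 0).toNat, Nat.testBit_and,
          Nat.testBit_two_pow_mul_add _ h1w, Nat.testBit_two_pow_mul_add _ hb]
        split_ifs with hi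
        · rcases i with _ | i
          · cases t.testBit 0 <;> simp
          · cases t.testBit 0 <;> simp [Nat.testBit_succ]
        · rw [Nat.testBit_and, Nat.testBit_shiftRight, Nat.add_sub_cancel' (not_lt.1 hi)]
      rw [h1, Finset.sum_range_succ']
      have h2 : 2 ^ w ≡ 1 [MOD 2 ^ w - 1] := by
        conv_lhs => rw [← hw]
        simp [Nat.ModEq]
      have h3 := (h2.mul (ih (t >>> w)))
      rw [one_mul] at h3
      rw [add_comm, mul_zero]
      refine Nat.ModEq.add_right _ (h3.trans ?_)
      simp only [Nat.testBit_shiftRight, mul_add, mul_one]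
      simp_rw [add_comm w]
      rfl
  -- the sum has at most `n < 2 ^ w - 1` ones, so the reduction does not change it
  have hr : ∀ r, ((t >>> r) &&& ((2 ^ (w * n) - 1) / (2 ^ w - 1))) % (2 ^ w - 1) =
      ∑ i ∈ Finset.range n, (t.testBit (w * i + r)).toNat := by
    intro r
    have h1 := hfold n (t >>> r)
    rw [Nat.ModEq] at h1
    rw [h1, Nat.mod_eq_of_lt]
    · simp [Nat.testBit_shiftRight, add_comm]
    · refine lt_of_le_of_lt (Finset.sum_le_card_nsmul _ _ 1 fun i _ => Bool.toNat_le _) ?_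
      simpa using hn
  rw [popcount, List.map_congr_left fun r _ => hr r, Finset.card_filter]
  change ∑ r ∈ Finset.range w, ∑ i ∈ Finset.range n, (t.testBit (w * i + r)).toNat = _
  rw [Finset.sum_comm]
  clear hn hr
  induction n with
  | zero => simp
  | succ n ih =>
    rw [Finset.sum_range_succ, ih, mul_add, mul_one, Finset.sum_range_add]
    refine congrArg _ (Finset.sum_congr rfl fun r _ => ?_)
    cases t.testBit (w * n + r) <;> rfl

open Equiv Equiv.Perm

/-! ### Orbit counting for tournaments -/

/-- Permutations act on labelled tournaments by moving the labels. -/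
instance tournamentAction (n : ℕ) : MulAction (Perm (Fin n)) (Tournament n) where
  smul g T := ⟨⟨fun u v => T.1.Adj (g⁻¹ u) (g⁻¹ v)⟩, T.2.comap (g⁻¹).toEmbedding⟩
  one_smul _ := rfl
  mul_smul _ _ _ := rfl

theorem smul_adj {n : ℕ} (g : Perm (Fin n)) (T : Tournament n) (u v : Fin n) :
    (g • T).1.Adj u v ↔ T.1.Adj (g⁻¹ u) (g⁻¹ v) := Iff.rfl

theorem smul_adj_apply {n : ℕ} (g : Perm (Fin n)) (T : Tournament n) (u v : Fin n) :
    (g • T).1.Adj (g u) (g v) ↔ T.1.Adj u v := by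
  simp [smul_adj]

theorem tournament_ext {n : ℕ} {S T : Tournament n} (h : ∀ u v, S.1.Adj u v ↔ T.1.Adj u v) :
    S = T :=
  Subtype.ext (Digraph.ext (funext fun u => funext fun v => propext (h u v)))

theorem smul_eq_self_iff {n : ℕ} {g : Perm (Fin n)} {T : Tournament n} :
    g • T = T ↔ ∀ u v, T.1.Adj (g u) (g v) ↔ T.1.Adj u v := by
  constructor
  · intro h u v
    conv_lhs => rw [← h]
    exact smul_adj_apply g T u v
  · intro h
    refine tournament_ext fun u v => ?_
    rw [smul_adj, ← h (g⁻¹ u) (g⁻¹ v)]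
    simp

theorem equiv_iff_exists_smul_eq {n : ℕ} {S T : Tournament n} :
    (tournamentSetoid n).r S T ↔ ∃ g : Perm (Fin n), g • T = S := by
  constructor
  · rintro ⟨e⟩
    refine ⟨e.toEquiv.symm, tournament_ext fun u v => ?_⟩
    exact e.map_rel_iff
  · rintro ⟨g, rfl⟩
    exact ⟨g⁻¹, Iff.rfl⟩

theorem IsCritical.smul {n : ℕ} (g : Perm (Fin n)) (T : Tournament n) (h : IsCritical T.1) :
    IsCritical (g • T).1 := by
  refine ⟨fun v => ?_, fun h2 => h.2 ?_⟩
  · have := (h.1 (g⁻¹ v)).preimage (D := (g • T).1) (f := ⇑g⁻¹) fun _ _ h => h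
    convert this
    ext u
    simp
  · exact h2.preimage (f := g) fun u v huv => (smul_adj_apply g T u v).2 huv

/-- The number of labelled tournaments that satisfy `P`. -/
noncomputable def countTournaments {n : ℕ} (P : Tournament n → Prop) : ℕ :=
  Nat.card {T : Tournament n // P T}

instance (n : ℕ) : Finite (Tournament n) := Subtype.finite

/-- The orbit-counting lemma for a property of tournaments that is invariant under relabelling. -/
theorem ncard_classes_mul_factorial {n : ℕ} {P : Tournament n → Prop}
    (hP : ∀ (g : Perm (Fin n)) T, P T → P (g • T)) :
    {q : TournamentClass n | ∃ T, Quotient.mk (tournamentSetoid n) T = q ∧ P T}.ncard *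
      n.factorial = ∑ g : Perm (Fin n), countTournaments fun T => P T ∧ g • T = T := by
  classical
  let X : SubMulAction (Perm (Fin n)) (Tournament n) := ⟨{T | P T}, fun g {T} h => hP g T h⟩
  have : Fintype X := Fintype.ofFinite _
  have : Fintype (Quotient (MulAction.orbitRel (Perm (Fin n)) X)) := Fintype.ofFinite _
  have hB := MulAction.sum_card_fixedBy_eq_card_orbits_mul_card_group (Perm (Fin n)) X
  rw [Fintype.card_perm, Fintype.card_fin] at hB
  let F : Quotient (MulAction.orbitRel (Perm (Fin n)) X) →
      {q : TournamentClass n | ∃ T, Quotient.mk (tournamentSetoid n) T = q ∧ P T} :=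
    Quotient.lift (fun T => ⟨Quotient.mk (tournamentSetoid n) T.1, T.1, rfl, T.2⟩) (by
      rintro S T ⟨g, hg⟩
      refine Subtype.ext (Quotient.sound (equiv_iff_exists_smul_eq.2 ⟨g, ?_⟩))
      exact congrArg Subtype.val hg)
  have hF : Function.Bijective F := by
    constructor
    · rintro ⟨S⟩ ⟨T⟩ h
      obtain ⟨g, hg⟩ := equiv_iff_exists_smul_eq.1 (Quotient.exact (congrArg Subtype.val h))
      exact Quotient.sound ⟨g, Subtype.ext hg⟩
    · rintro ⟨_, T, rfl, hT⟩
      exact ⟨Quotient.mk _ ⟨T, hT⟩, rfl⟩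
  rw [← Nat.card_coe_set_eq, ← Nat.card_congr (Equiv.ofBijective F hF), Nat.card_eq_fintype_card,
    ← hB]
  refine Finset.sum_congr rfl fun g _ => ?_
  rw [← Nat.card_eq_fintype_card]
  refine Nat.card_congr ⟨fun T => ⟨T.1.1, T.1.2, congrArg Subtype.val T.2⟩,
    fun T => ⟨⟨T.1, T.2.1⟩, Subtype.ext T.2.2⟩, fun _ => rfl, fun _ => rfl⟩

theorem countTournaments_smul {n : ℕ} {P Q : Tournament n → Prop} (g : Perm (Fin n))
    (h : ∀ T, P T ↔ Q (g • T)) : countTournaments P = countTournaments Q :=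
  Nat.card_congr ((MulAction.toPerm g).subtypeEquiv h)

/-- The number of fixed tournaments with an invariant property depends on the cycle type only. -/
theorem countTournaments_fixed_congr {n : ℕ} {P : Tournament n → Prop}
    (hP : ∀ (g : Perm (Fin n)) T, P T → P (g • T)) {g h : Perm (Fin n)}
    (hgh : g.cycleType = h.cycleType) :
    (countTournaments fun T => P T ∧ g • T = T) = countTournaments fun T => P T ∧ h • T = T := by
  obtain ⟨c, hc⟩ := isConj_iff.1 (isConj_iff_cycleType_eq.2 hgh)
  refine countTournaments_smul c fun T => and_congr ⟨hP c T, fun h => ?_⟩ ?_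
  · simpa using hP c⁻¹ _ h
  · rw [← hc, mul_smul, mul_smul, inv_smul_smul, smul_left_cancel_iff]

/-- A permutation with a cycle of even length fixes no tournament: one of its powers exchanges
two vertices. -/
theorem even_notMem_cycleType_of_smul_eq {n : ℕ} {g : Perm (Fin n)} {T : Tournament n}
    (hT : g • T = T) {k : ℕ} (hk : k ∈ g.cycleType) : ¬ Even k := by
  intro hev
  have h2 : 2 ∣ orderOf g := hev.two_dvd.trans (dvd_of_mem_cycleType hk)
  have hpos : 0 < orderOf g := orderOf_pos g
  have ho : orderOf (g ^ (orderOf g / 2)) = 2 :=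
    orderOf_pow_orderOf_div hpos.ne' h2
  set s := g ^ (orderOf g / 2) with hs
  have hsT : s • T = T := MulAction.mem_stabilizer_iff.1
    (Subgroup.pow_mem _ (MulAction.mem_stabilizer_iff.2 hT) _)
  have hs1 : s ≠ 1 := by
    intro h
    rw [h, orderOf_one] at ho
    omega
  obtain ⟨v, hv⟩ : ∃ v, s v ≠ v := by
    by_contra h
    push Not at h
    exact hs1 (Equiv.ext h)
  have hss : s (s v) = v := by
    have := pow_orderOf_eq_one s
    rw [ho, sq] at this
    exact congrArg (fun p : Perm (Fin n) => p v) this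
  have h := smul_eq_self_iff.1 hsT (s v) v
  rw [hss] at h
  by_cases hadj : T.1.Adj v (s v)
  · exact T.2.asymm hadj (h.1 hadj)
  · exact hadj (h.2 ((T.2.not_adj_iff hv.symm).1 hadj))

/-- The cycle types of the permutations of eight points without cycles of even length. -/
def oddCycleTypes : Finset (Multiset ℕ) := {0, {3}, {3, 3}, {5}, {5, 3}, {7}}

theorem mem_oddCycleTypes {m : Multiset ℕ} (h8 : m.sum ≤ 8) (h2 : ∀ k ∈ m, 2 ≤ k)
    (hodd : ∀ k ∈ m, ¬ Even k) : m ∈ oddCycleTypes := by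
  have h3 : ∀ k ∈ m, 3 ≤ k := fun k hk => by
    have := h2 k hk
    have := hodd k hk
    rcases Nat.lt_or_ge k 3 with h | h
    · interval_cases k; exact absurd even_two this
    · exact h
  have hcard : Multiset.card m * 3 ≤ m.sum := by
    simpa using Multiset.card_nsmul_le_sum h3
  have hcases : ∀ k, 3 ≤ k → k ≤ 8 → ¬ Even k → k = 3 ∨ k = 5 ∨ k = 7 := by
    intro k _ _ hk
    interval_cases k <;> simp_all [Nat.even_iff]
  have hle : Multiset.card m ≤ 2 := by omega
  obtain h | h | h : Multiset.card m = 0 ∨ Multiset.card m = 1 ∨ Multiset.card m = 2 := by omega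
  · rw [Multiset.card_eq_zero] at h
    subst h
    decide
  · obtain ⟨a, rfl⟩ := Multiset.card_eq_one.1 h
    simp only [Multiset.mem_singleton, forall_eq, Multiset.sum_singleton] at h3 hodd h8
    rcases hcases a h3 h8 hodd with rfl | rfl | rfl <;> decide
  · obtain ⟨a, b, rfl⟩ := Multiset.card_eq_two.1 h
    simp only [Multiset.insert_eq_cons, Multiset.mem_cons, Multiset.mem_singleton, forall_eq_or_imp,
      forall_eq, Multiset.sum_cons, Multiset.sum_singleton] at h3 hodd h8
    rcases hcases a h3.1 (by omega) hodd.1 with rfl | rfl | rfl <;>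
    rcases hcases b h3.2 (by omega) hodd.2 with rfl | rfl | rfl <;>
    first
    | omega
    | decide

/-- The class equation for the number of fixed tournaments on eight vertices. The coefficients
are the numbers of permutations of the six cycle types without even cycles. -/
theorem sum_countTournaments_fixed {P : Tournament 8 → Prop}
    (hP : ∀ (g : Perm (Fin 8)) T, P T → P (g • T)) :
    ∑ g : Perm (Fin 8), (countTournaments fun T => P T ∧ g • T = T) =
      countTournaments P +
      112 * (countTournaments fun T => P T ∧ (c[0, 1, 2] : Perm (Fin 8)) • T = T) +
      1120 * (countTournaments fun T => P T ∧ (c[0, 1, 2] * c[3, 4, 5] : Perm (Fin 8)) • T = T) +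
      1344 * (countTournaments fun T => P T ∧ (c[0, 1, 2, 3, 4] : Perm (Fin 8)) • T = T) +
      2688 * (countTournaments fun T =>
        P T ∧ (c[0, 1, 2, 3, 4] * c[5, 6, 7] : Perm (Fin 8)) • T = T) +
      5760 * (countTournaments fun T =>
        P T ∧ (c[0, 1, 2, 3, 4, 5, 6] : Perm (Fin 8)) • T = T) := by
  have hfib : ∀ (m : Multiset ℕ) (h : Perm (Fin 8)) (N : ℕ), h.cycleType = m →
      (Finset.univ.filter fun g : Perm (Fin 8) => g.cycleType = m).card = N →
      ∑ g ∈ Finset.univ.filter (fun g : Perm (Fin 8) => g.cycleType = m),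
        (countTournaments fun T => P T ∧ g • T = T) =
        N * countTournaments fun T => P T ∧ h • T = T := by
    intro m h N hm hN
    rw [← hN, ← smul_eq_mul, ← Finset.sum_const]
    refine Finset.sum_congr rfl fun g hg => countTournaments_fixed_congr hP ?_
    rw [hm]
    simpa using hg
  have hzero : ∀ g : Perm (Fin 8), (countTournaments fun T => P T ∧ g • T = T) ≠ 0 →
      g.cycleType ∈ oddCycleTypes := by
    intro g hg
    obtain ⟨⟨T, -, hT⟩⟩ := (Nat.card_ne_zero.1 hg).1
    exact mem_oddCycleTypes (by simpa using sum_cycleType_le g)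
      (fun k hk => two_le_of_mem_cycleType hk) fun k hk => even_notMem_cycleType_of_smul_eq hT hk
  rw [← Finset.sum_filter_of_ne fun g _ => hzero g,
    ← Finset.sum_fiberwise_of_maps_to (t := oddCycleTypes)
      (g := fun g : Perm (Fin 8) => g.cycleType)
      (fun g hg => (Finset.mem_filter.1 hg).2)]
  have hff : ∀ m ∈ oddCycleTypes, (Finset.univ.filter fun g : Perm (Fin 8) =>
      g.cycleType ∈ oddCycleTypes).filter (fun g => g.cycleType = m) =
      Finset.univ.filter fun g : Perm (Fin 8) => g.cycleType = m := by
    intro m hm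
    ext g
    simp only [Finset.mem_filter, Finset.mem_univ, true_and, and_iff_right_iff_imp]
    rintro rfl
    exact hm
  rw [Finset.sum_congr rfl fun m hm => by rw [hff m hm]]
  rw [oddCycleTypes, Finset.sum_insert (by decide), Finset.sum_insert (by decide),
    Finset.sum_insert (by decide), Finset.sum_insert (by decide), Finset.sum_insert (by decide),
    Finset.sum_singleton]
  rw [hfib 0 1 1 (by simp) (by rw [card_of_cycleType]; decide +kernel),
    hfib {3} c[0, 1, 2] 112 (by decide +kernel) (by rw [card_of_cycleType]; decide +kernel),
    hfib {3, 3} (c[0, 1, 2] * c[3, 4, 5]) 1120 (by decide +kernel)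
      (by rw [card_of_cycleType]; decide +kernel),
    hfib {5} c[0, 1, 2, 3, 4] 1344 (by decide +kernel) (by rw [card_of_cycleType]; decide +kernel),
    hfib {5, 3} (c[0, 1, 2, 3, 4] * c[5, 6, 7]) 2688 (by decide +kernel)
      (by rw [card_of_cycleType]; decide +kernel),
    hfib {7} c[0, 1, 2, 3, 4, 5, 6] 5760 (by decide +kernel)
      (by rw [card_of_cycleType]; decide +kernel)]
  simp only [one_smul, and_true, one_mul]
  ring

/-! ### Parametrized families of tournaments -/

/-- The presence of an arc, as a function of binary parameters: a constant, or the `k`-th parameter,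
negated if `neg` is `true`. -/
inductive Literal
  | const (b : Bool)
  | var (k : ℕ) (neg : Bool)
deriving DecidableEq

/-- The value of a literal if the parameters are the binary digits of `x`. -/
def Literal.eval (x : ℕ) : Literal → Bool
  | const b => b
  | var k neg => x.testBit k ^^ neg

/-- The table of the values of a literal on the codes below `2 ^ m`. -/
def Literal.table (m : ℕ) : Literal → ℕ
  | const b => bif b then 2 ^ 2 ^ m - 1 else 0
  | var k neg => bif neg then (2 ^ 2 ^ m - 1) ^^^ varTable k m else varTable k m

/-- The opposite literal. -/
def Literal.compl : Literal → Literal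
  | const b => const !b
  | var k neg => var k !neg

theorem Literal.eval_compl (x : ℕ) (l : Literal) : l.compl.eval x = !l.eval x := by
  cases l <;> simp [compl, eval]

/-- The number of the last parameter of a literal, plus one. -/
def Literal.bound : Literal → ℕ
  | const _ => 0
  | var k _ => k + 1

theorem Literal.testBit_table {m x : ℕ} (hx : x < 2 ^ m) {l : Literal} (hl : l.bound ≤ m) :
    (l.table m).testBit x = l.eval x := by
  rcases l with b | ⟨k, neg⟩
  · cases b <;> simp [table, eval, hx]
  · cases neg <;> simp [table, eval, hx, testBit_varTable (k := k) hl hx, Bool.xor_comm]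

section Parametrization

variable (g : Perm (Fin 8)) (arcs src : List (Fin 8 × Fin 8)) (L : Fin 8 → Fin 8 → Literal)

/-- The tournament is fixed by `g` and contains the prescribed arcs. -/
def Fits (T : Tournament 8) : Prop := g • T = T ∧ ∀ p ∈ arcs, T.1.Adj p.1 p.2

/-- The test that a literal proposed for the pair `(u, v)` is forced in every tournament that is
fixed by `g`, contains the prescribed arcs, and has the parameters as values at the pairs `src`: a
constant must come from a prescribed arc, and a parameter must be carried from its pair to `(u, v)`
or `(v, u)` by a power of `g`. The bound `15` is the largest order of a permutation of eight points
without cycles of even length. -/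
def forced (u v : Fin 8) : Literal → Bool
  | .const true => decide ((u, v) ∈ arcs)
  | .const false => decide (u = v ∨ (v, u) ∈ arcs)
  | .var k neg => decide (k < src.length ∧ ∃ i < 15,
      ((g ^ i) (src.getD k (0, 0)).1, (g ^ i) (src.getD k (0, 0)).2) =
        bif neg then (v, u) else (u, v))

/-- The matrix `L` of literals parametrizes the tournaments that are fixed by `g` and contain
the prescribed arcs; the parameters are the values at the pairs `src`. The first two conditions
make every choice of parameters a tournament, the third one makes the parameters independent, the
next two put the tournament into the family, and the last one makes the family exhausted. -/
def Parametrizes : Prop :=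
  (∀ u, L u u = .const false) ∧ (∀ u v, u ≠ v → L v u = (L u v).compl) ∧
  (∀ k < src.length, L (src.getD k (0, 0)).1 (src.getD k (0, 0)).2 = .var k false) ∧
  (∀ u v, L (g u) (g v) = L u v) ∧ (∀ p ∈ arcs, L p.1 p.2 = .const true) ∧
  ∀ u v, forced g arcs src u v (L u v) = true

instance : Decidable (Parametrizes g arcs src L) := by unfold Parametrizes; infer_instance

variable {g arcs src L}

/-- The tournament with parameters the binary digits of `x`. -/
def ofCode (h : Parametrizes g arcs src L) (x : ℕ) : Tournament 8 :=
  ⟨⟨fun u v => (L u v).eval x = true⟩, by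
    refine ⟨fun u => by simp [h.1, Literal.eval], fun u v huv => ?_⟩
    simp only [h.2.1 u v huv, Literal.eval_compl]
    cases (L u v).eval x <;> simp⟩

theorem fits_ofCode (h : Parametrizes g arcs src L) (x : ℕ) : Fits g arcs (ofCode h x) := by
  refine ⟨smul_eq_self_iff.2 fun u v => ?_, fun p hp => ?_⟩
  · simp only [ofCode, h.2.2.2.1]
  · simp only [ofCode, h.2.2.2.2.1 p hp, Literal.eval]

theorem bound_le (h : Parametrizes g arcs src L) (u v : Fin 8) : (L u v).bound ≤ src.length := by
  have := h.2.2.2.2.2 u v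
  rcases hL : L u v with b | ⟨k, neg⟩
  · exact Nat.zero_le _
  · rw [hL] at this
    simp only [forced, decide_eq_true_eq] at this
    exact this.1

theorem ofCode_injOn (h : Parametrizes g arcs src L) :
    Set.InjOn (ofCode h) {x | x < 2 ^ src.length} := by
  intro x hx y hy hxy
  refine Nat.eq_of_testBit_eq fun k => ?_
  by_cases hk : k < src.length
  · have h1 : ∀ u v, (L u v).eval x = true ↔ (L u v).eval y = true := by
      intro u v
      exact iff_of_eq (congrArg (fun T : Tournament 8 => T.1.Adj u v) hxy)
    have h2 := h1 (src.getD k (0, 0)).1 (src.getD k (0, 0)).2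
    rw [h.2.2.1 k hk] at h2
    simpa [Literal.eval] using Bool.eq_iff_iff.2 h2
  · have hle : 2 ^ src.length ≤ 2 ^ k := Nat.pow_le_pow_right two_pos (not_lt.1 hk)
    rw [Nat.testBit_lt_two_pow (lt_of_lt_of_le hx hle),
      Nat.testBit_lt_two_pow (lt_of_lt_of_le hy hle)]

theorem exists_ofCode_eq (h : Parametrizes g arcs src L) {T : Tournament 8} (hT : Fits g arcs T) :
    ∃ x < 2 ^ src.length, ofCode h x = T := by
  classical
  refine ⟨Nat.ofBits fun k : Fin src.length =>
    decide (T.1.Adj (src.getD k (0, 0)).1 (src.getD k (0, 0)).2), Nat.ofBits_lt_two_pow _,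
    tournament_ext fun u v => ?_⟩
  have hpow : ∀ (i : ℕ) (u v : Fin 8), T.1.Adj ((g ^ i) u) ((g ^ i) v) ↔ T.1.Adj u v := fun i =>
    smul_eq_self_iff.1 (MulAction.mem_stabilizer_iff.1
      (Subgroup.pow_mem _ (MulAction.mem_stabilizer_iff.2 hT.1) i))
  have hf := h.2.2.2.2.2 u v
  simp only [ofCode]
  rcases hL : L u v with b | ⟨k, neg⟩ <;> rw [hL] at hf
  · cases b <;> simp only [forced, decide_eq_true_eq] at hf <;> simp only [Literal.eval]
    · rcases hf with rfl | hf
      · simpa using T.2.1 u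
      · simpa using T.2.asymm (hT.2 _ hf)
    · simpa using hT.2 _ hf
  · simp only [forced, decide_eq_true_eq] at hf
    obtain ⟨hk, i, -, hi⟩ := hf
    have hp := hpow i (src.getD k (0, 0)).1 (src.getD k (0, 0)).2
    rw [Literal.eval, Nat.testBit_ofBits_lt _ _ hk]
    cases neg <;> simp only [cond_true, cond_false, Prod.mk.injEq] at hi <;> rw [hi.1, hi.2] at hp
    · simpa using hp.symm
    · have huv : u ≠ v := by
        rintro rfl
        rw [h.1] at hL
        cases hL
      have hneg := T.2.not_adj_iff huv.symm
      rw [hp] at hneg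
      simpa using hneg

theorem countTournaments_fits_and (h : Parametrizes g arcs src L) (Q : Tournament 8 → Prop)
    [DecidablePred fun x => Q (ofCode h x)] :
    (countTournaments fun T => Q T ∧ Fits g arcs T) =
      ((Finset.range (2 ^ src.length)).filter fun x => Q (ofCode h x)).card := by
  rw [countTournaments, ← Nat.card_eq_finsetCard]
  symm
  refine Nat.card_congr (Equiv.ofBijective (fun x => ⟨ofCode h x.1,
    (Finset.mem_filter.1 x.2).2, fits_ofCode h _⟩) ⟨fun x y hxy => ?_, fun T => ?_⟩)
  · exact Subtype.ext (ofCode_injOn h (Finset.mem_range.1 (Finset.mem_filter.1 x.2).1)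
      (Finset.mem_range.1 (Finset.mem_filter.1 y.2).1) (congrArg Subtype.val hxy))
  · obtain ⟨T, hQ, hT⟩ := T
    obtain ⟨x, hx, rfl⟩ := exists_ofCode_eq h hT
    exact ⟨⟨x, Finset.mem_filter.2 ⟨Finset.mem_range.2 hx, hQ⟩⟩, rfl⟩

theorem countTournaments_fits (h : Parametrizes g arcs src L) :
    (countTournaments fun T => True ∧ Fits g arcs T) = 2 ^ src.length := by
  rw [countTournaments_fits_and h]
  simp

/-- The critical tournaments of a parametrized family are counted by the ones of a truth table. -/
theorem countTournaments_isCritical_fits (h : Parametrizes g arcs src L) {m w n : ℕ}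
    (hm : src.length = m) (hwn : w * n = 2 ^ m) (hn : n < 2 ^ w - 1) :
    (countTournaments fun T => IsCritical T.1 ∧ Fits g arcs T) =
      popcount w n (criticalTable (fun u v => (L u v).table m) (2 ^ 2 ^ m - 1)
        [0, 1, 2, 3, 4, 5, 6, 7]) := by
  classical
  subst hm
  rw [countTournaments_fits_and h, popcount_eq hn, hwn]
  refine congrArg _ (Finset.filter_congr fun x hx => ?_)
  have hx := Finset.mem_range.1 hx
  refine (testBit_criticalTable (by simp [hx]) (ofCode h x).2 (fun u v => ?_) (by decide)).symm
  rw [Literal.testBit_table hx (bound_le h u v)]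
  rfl

end Parametrization

/-- The pairs `(u, v)` with `k ≤ u < v`, ordered by `v`. -/
def increasingPairs (k : ℕ) : List (Fin 8 × Fin 8) :=
  (List.finRange 8).flatMap fun v =>
    ((List.finRange 8).filter fun u => k ≤ u.1 ∧ u < v).map fun u => (u, v)

/-- Representatives of the orbits of `g` on the unordered pairs of vertices: in each orbit, the
first pair in the order by the larger vertex. The number `k` is the order of `g`. -/
def orbitPairs (g : Perm (Fin 8)) (k : ℕ) : List (Fin 8 × Fin 8) :=
  (increasingPairs 0).filter fun p => ∀ i < k,
    8 * p.2.1 + p.1.1 ≤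
      8 * (max ((g ^ i) p.1) ((g ^ i) p.2)).1 + (min ((g ^ i) p.1) ((g ^ i) p.2)).1

/-- The matrix of literals that spreads parameters at the pairs `orbitPairs g k` over the orbits
of `g`, where `k` is the order of `g`. The default value is attained only if some pair lies in no
represented orbit. -/
def orbitLiteral (g : Perm (Fin 8)) (k : ℕ) (u v : Fin 8) : Literal :=
  if u = v then .const false
  else ((orbitPairs g k).zipIdx.findSome? fun p => (List.range k).findSome? fun i =>
    if ((g ^ i) p.1.1, (g ^ i) p.1.2) = (u, v) then some (.var p.2 false)
    else if ((g ^ i) p.1.1, (g ^ i) p.1.2) = (v, u) then some (.var p.2 true)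
    else none).getD (.const false)

/-- The matrix of literals in which every pair has a parameter of its own, in the order of
`increasingPairs 0`. -/
def pairLiteral (u v : Fin 8) : Literal :=
  if u = v then .const false
  else if u < v then .var (v.1 * (v.1 - 1) / 2 + u.1) false
  else .var (u.1 * (u.1 - 1) / 2 + v.1) true

/-- The arcs between the vertex `0` and the others, if the out-neighbours of `0` are `1, …, d`. -/
def starArcs (d : ℕ) : List (Fin 8 × Fin 8) :=
  ((List.finRange 8).filter (· ≠ 0)).map fun v => if v.1 ≤ d then (0, v) else (v, 0)

/-- The matrix of literals in which the out-neighbours of `0` are `1, …, d`, and the other pairs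
have parameters of their own, in the order of `increasingPairs 1`. -/
def starLiteral (d : ℕ) (u v : Fin 8) : Literal :=
  if u = v then .const false
  else if u = 0 then .const (Nat.ble v.1 d)
  else if v = 0 then .const (Nat.blt d u.1)
  else if u < v then .var ((v.1 - 1) * (v.1 - 2) / 2 + (u.1 - 1)) false
  else .var ((u.1 - 1) * (u.1 - 2) / 2 + (v.1 - 1)) true

/-- The counts of all and of the critical tournaments fixed by `g`, reduced to evaluations: `k` is
the order of `g`, `m` the number of its orbits on pairs, and `w` and `n` split the `2 ^ m` digits of
the table for `popcount`. -/
theorem countTournaments_fixed_of_parametrizes {g : Perm (Fin 8)} (k : ℕ) {m w n N : ℕ}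
    (h : Parametrizes g [] (orbitPairs g k) (orbitLiteral g k) ∧
      (orbitPairs g k).length = m ∧ w * n = 2 ^ m ∧ n < 2 ^ w - 1)
    (hN : popcount w n (criticalTable
      (fun u v => (orbitLiteral g k u v).table m) (2 ^ 2 ^ m - 1)
        [0, 1, 2, 3, 4, 5, 6, 7]) = N) :
    (countTournaments fun T : Tournament 8 => True ∧ g • T = T) = 2 ^ m ∧
    (countTournaments fun T : Tournament 8 => IsCritical T.1 ∧ g • T = T) = N := by
  have h1 := countTournaments_fits h.1
  have h2 := countTournaments_isCritical_fits h.1 h.2.1 h.2.2.1 h.2.2.2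
  simp only [Fits, List.not_mem_nil, false_imp_iff, implies_true, and_true] at h1 h2
  exact ⟨by rw [h1, h.2.1], by rw [h2, hN]⟩

theorem countTournaments_true : countTournaments (fun _ : Tournament 8 => True) = 2 ^ 28 := by
  have h : Parametrizes 1 [] (increasingPairs 0) pairLiteral := by decide +kernel
  have h1 := countTournaments_fits h
  simp only [Fits, List.not_mem_nil, false_imp_iff, implies_true, and_true, one_smul] at h1
  rw [h1, show (increasingPairs 0).length = 28 by decide +kernel]

theorem countTournaments_star (d N : ℕ)
    (h : Parametrizes 1 (starArcs d) (increasingPairs 1) (starLiteral d))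
    (hN : popcount 32 (2 ^ 16) (criticalTable (fun u v => (starLiteral d u v).table 21)
      (2 ^ 2 ^ 21 - 1) [0, 1, 2, 3, 4, 5, 6, 7]) = N) :
    (countTournaments fun T => IsCritical T.1 ∧ ∀ p ∈ starArcs d, T.1.Adj p.1 p.2) = N := by
  have h2 := countTournaments_isCritical_fits h (m := 21) (w := 32) (n := 2 ^ 16)
    (by decide +kernel) (by norm_num) (by norm_num)
  simp only [Fits, one_smul, true_and] at h2
  rw [h2, hN]

/-! ### The evaluated truth tables -/

set_option maxRecDepth 10000

theorem counts_three :
    (countTournaments fun T : Tournament 8 => True ∧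
      (c[0, 1, 2] : Perm (Fin 8)) • T = T) = 2 ^ 16 ∧
    (countTournaments fun T : Tournament 8 => IsCritical T.1 ∧
      (c[0, 1, 2] : Perm (Fin 8)) • T = T) = 960 :=
  countTournaments_fixed_of_parametrizes 3 (w := 32) (n := 2 ^ 11)
    (by decide +kernel) (by decide +kernel)

theorem counts_three_three :
    (countTournaments fun T : Tournament 8 => True ∧
      (c[0, 1, 2] * c[3, 4, 5] : Perm (Fin 8)) • T = T) = 2 ^ 10 ∧
    (countTournaments fun T : Tournament 8 => IsCritical T.1 ∧
      (c[0, 1, 2] * c[3, 4, 5] : Perm (Fin 8)) • T = T) = 0 :=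
  countTournaments_fixed_of_parametrizes 3 (w := 16) (n := 2 ^ 6)
    (by decide +kernel) (by decide +kernel)

theorem counts_five :
    (countTournaments fun T : Tournament 8 => True ∧
      (c[0, 1, 2, 3, 4] : Perm (Fin 8)) • T = T) = 2 ^ 8 ∧
    (countTournaments fun T : Tournament 8 => IsCritical T.1 ∧
      (c[0, 1, 2, 3, 4] : Perm (Fin 8)) • T = T) = 0 :=
  countTournaments_fixed_of_parametrizes 5 (w := 8) (n := 2 ^ 5)
    (by decide +kernel) (by decide +kernel)

theorem counts_five_three :
    (countTournaments fun T : Tournament 8 => True ∧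
      (c[0, 1, 2, 3, 4] * c[5, 6, 7] : Perm (Fin 8)) • T = T) = 2 ^ 4 ∧
    (countTournaments fun T : Tournament 8 => IsCritical T.1 ∧
      (c[0, 1, 2, 3, 4] * c[5, 6, 7] : Perm (Fin 8)) • T = T) = 0 :=
  countTournaments_fixed_of_parametrizes 15 (w := 4) (n := 2 ^ 2)
    (by decide +kernel) (by decide +kernel)

theorem counts_seven :
    (countTournaments fun T : Tournament 8 => True ∧
      (c[0, 1, 2, 3, 4, 5, 6] : Perm (Fin 8)) • T = T) = 2 ^ 4 ∧
    (countTournaments fun T : Tournament 8 => IsCritical T.1 ∧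
      (c[0, 1, 2, 3, 4, 5, 6] : Perm (Fin 8)) • T = T) = 0 :=
  countTournaments_fixed_of_parametrizes 7 (w := 4) (n := 2 ^ 2)
    (by decide +kernel) (by decide +kernel)

/-- The number of critical tournaments on eight vertices in which the out-neighbours of `0`
are `1, …, d`. -/
noncomputable def criticalStarCount (d : ℕ) : ℕ :=
  countTournaments fun T => IsCritical T.1 ∧ ∀ p ∈ starArcs d, T.1.Adj p.1 p.2

theorem criticalStarCount_zero : criticalStarCount 0 = 0 :=
  countTournaments_star 0 _ (by decide +kernel) (by decide +kernel)

theorem criticalStarCount_one : criticalStarCount 1 = 0 :=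
  countTournaments_star 1 _ (by decide +kernel) (by decide +kernel)

theorem criticalStarCount_two : criticalStarCount 2 = 12000 :=
  countTournaments_star 2 _ (by decide +kernel) (by decide +kernel)

theorem criticalStarCount_three : criticalStarCount 3 = 28128 :=
  countTournaments_star 3 _ (by decide +kernel) (by decide +kernel)

theorem criticalStarCount_four : criticalStarCount 4 = 28128 :=
  countTournaments_star 4 _ (by decide +kernel) (by decide +kernel)

theorem criticalStarCount_five : criticalStarCount 5 = 12000 :=
  countTournaments_star 5 _ (by decide +kernel) (by decide +kernel)

theorem criticalStarCount_six : criticalStarCount 6 = 0 :=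
  countTournaments_star 6 _ (by decide +kernel) (by decide +kernel)

theorem criticalStarCount_seven : criticalStarCount 7 = 0 :=
  countTournaments_star 7 _ (by decide +kernel) (by decide +kernel)

/-! ### Sorting by the out-neighbourhood of a vertex -/

/-- The set of out-neighbours of the vertex `0`. -/
noncomputable def outZero (T : Tournament 8) : Finset (Fin 8) := by
  classical exact Finset.univ.filter fun v => T.1.Adj 0 v

theorem mem_outZero {T : Tournament 8} {v : Fin 8} : v ∈ outZero T ↔ T.1.Adj 0 v := by
  simp [outZero]

theorem outZero_subset (T : Tournament 8) : outZero T ⊆ Finset.univ.erase 0 := by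
  intro v hv
  rw [Finset.mem_erase]
  refine ⟨?_, Finset.mem_univ v⟩
  rintro rfl
  exact T.2.1 _ (mem_outZero.1 hv)

theorem outZero_eq_iff_starArcs {T : Tournament 8} (d : ℕ) :
    (∀ p ∈ starArcs d, T.1.Adj p.1 p.2) ↔
      outZero T = (Finset.univ.erase 0).filter fun v : Fin 8 => v.1 ≤ d := by
  have h1 : (∀ p ∈ starArcs d, T.1.Adj p.1 p.2) ↔
      ∀ v : Fin 8, v ≠ 0 → (T.1.Adj 0 v ↔ v.1 ≤ d) := by
    simp only [starArcs, List.forall_mem_map, List.mem_filter, List.mem_finRange, true_and,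
      decide_eq_true_eq]
    refine forall₂_congr fun v hv => ?_
    split_ifs with h
    · simp [h]
    · simp [h, T.2.not_adj_iff hv.symm]
  rw [h1, Finset.ext_iff]
  refine forall_congr' fun v => ?_
  rw [mem_outZero, Finset.mem_filter, Finset.mem_erase]
  by_cases hv : v = 0
  · subst hv
    simp [T.2.1]
  · simp [hv]

/-- Any two sets of equally many vertices other than `0` are exchanged by a relabelling
that fixes `0`. -/
theorem exists_perm_of_card_eq {S S' : Finset (Fin 8)} (hS : S ⊆ Finset.univ.erase 0)
    (hS' : S' ⊆ Finset.univ.erase 0) (h : S.card = S'.card) :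
    ∃ g : Perm (Fin 8), g 0 = 0 ∧ ∀ v, g v ∈ S' ↔ v ∈ S := by
  have h0 : (0 : Fin 8) ∉ S := fun h => by simpa using hS h
  have h0' : (0 : Fin 8) ∉ S' := fun h => by simpa using hS' h
  obtain ⟨e⟩ : Nonempty (S ≃ S') := Fintype.card_eq.1 (by simpa using h)
  obtain ⟨g, hg⟩ : ∃ g : Perm (Fin 8), ∀ v, g v ∈ S' ↔ v ∈ S :=
    ⟨e.extendSubtype, fun v => ⟨fun hv => by
      by_contra hvS
      exact e.extendSubtype_not_mem v hvS hv, fun hv => e.extendSubtype_mem v hv⟩⟩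
  -- both `g 0` and `0` lie outside `S'`, so `g` may be corrected by exchanging them
  refine ⟨swap (g 0) 0 * g, by simp, fun v => ?_⟩
  rw [Perm.mul_apply, ← hg v]
  have hg0 : g 0 ∉ S' := fun h => h0 ((hg 0).1 h)
  rcases eq_or_ne (g v) (g 0) with h1 | h1
  · simp [h1, h0', hg0]
  · rcases eq_or_ne (g v) 0 with h2 | h2
    · simp [h2, h0', hg0]
    · rw [swap_apply_of_ne_of_ne h1 h2]

/-- The labelled critical tournaments are sorted by the out-neighbourhood of the vertex `0`; those
with an out-neighbourhood of size `d` are, up to relabelling, counted by `criticalStarCount d`. -/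
theorem countTournaments_isCritical :
    (countTournaments fun T : Tournament 8 => IsCritical T.1) = 2472960 := by
  classical
  have : Fintype (Tournament 8) := Fintype.ofFinite _
  have hfib : (countTournaments fun T : Tournament 8 => IsCritical T.1) =
      ∑ S ∈ (Finset.univ.erase (0 : Fin 8)).powerset,
        countTournaments fun T => IsCritical T.1 ∧ outZero T = S := by
    simp only [countTournaments, Nat.card_eq_fintype_card, Fintype.card_subtype]
    rw [Finset.card_eq_sum_card_fiberwise
      (f := outZero) (t := (Finset.univ.erase (0 : Fin 8)).powerset)
      fun T _ => Finset.mem_coe.2 (Finset.mem_powerset.2 (outZero_subset T))]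
    simp only [Finset.filter_filter]
  have hstar : ∀ S ∈ (Finset.univ.erase (0 : Fin 8)).powerset,
      (countTournaments fun T => IsCritical T.1 ∧ outZero T = S) = criticalStarCount S.card := by
    intro S hS
    have hS := Finset.mem_powerset.1 hS
    have hcard : S.card ≤ 7 := Finset.card_le_card hS
    obtain ⟨g, hg0, hg⟩ := exists_perm_of_card_eq
      (S' := (Finset.univ.erase 0).filter fun v : Fin 8 => v.1 ≤ S.card) hS
      (Finset.filter_subset _ _) (by
        generalize S.card = d at hcard
        interval_cases d <;> rfl)
    refine countTournaments_smul g fun T => and_congr ⟨IsCritical.smul g T, fun h => ?_⟩ ?_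
    · simpa using IsCritical.smul g⁻¹ _ h
    · rw [outZero_eq_iff_starArcs, Finset.ext_iff, Finset.ext_iff,
        ← g.forall_congr_right (q := fun v => v ∈ outZero (g • T) ↔ _)]
      refine forall_congr' fun v => ?_
      rw [hg, mem_outZero, mem_outZero]
      conv_rhs => rw [← hg0, smul_adj_apply]
  rw [hfib, Finset.sum_congr rfl hstar, Finset.sum_powerset_apply_card]
  have h7 : (Finset.univ.erase (0 : Fin 8)).card = 7 := rfl
  rw [h7]
  simp only [Finset.sum_range_succ, Finset.sum_range_zero, criticalStarCount_zero,
    criticalStarCount_one, criticalStarCount_two, criticalStarCount_three, criticalStarCount_four,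
    criticalStarCount_five, criticalStarCount_six, criticalStarCount_seven]
  rfl

end Dicolor

theorem mainTheorem6 :
    Nat.card (Dicolor.TournamentClass 8) = 6880 ∧
    {q : Dicolor.TournamentClass 8 | ∃ T : Dicolor.Tournament 8,
      (Quotient.mk (Dicolor.tournamentSetoid 8) T) = q ∧
      Dicolor.dichromaticNumber T.1 = 3 ∧
      ∀ H : Dicolor.Tournament 7, Dicolor.dichromaticNumber H.1 = 3 →
        ¬ Dicolor.Contains T.1 H.1}.ncard = 64 := by
  have h8 : Nat.factorial 8 = 40320 := by decide
  constructor
  · have h := Dicolor.ncard_classes_mul_factorial (n := 8) (P := fun _ => True) fun _ _ h => h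
    rw [Dicolor.sum_countTournaments_fixed fun _ _ h => h, Dicolor.countTournaments_true,
      Dicolor.counts_three.1, Dicolor.counts_three_three.1, Dicolor.counts_five.1,
      Dicolor.counts_five_three.1, Dicolor.counts_seven.1, h8] at h
    rw [← Set.ncard_univ]
    have huniv : {q : Dicolor.TournamentClass 8 | ∃ T,
        Quotient.mk (Dicolor.tournamentSetoid 8) T = q ∧ True} = Set.univ :=
      Set.eq_univ_of_forall fun q => (Quotient.exists_rep q).imp fun T hT => ⟨hT, trivial⟩
    rw [huniv] at h
    exact Nat.eq_of_mul_eq_mul_right (by norm_num : 0 < 40320) (h.trans (by norm_num))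
  · have h := Dicolor.ncard_classes_mul_factorial (n := 8) (P := fun T => Dicolor.IsCritical T.1)
      Dicolor.IsCritical.smul
    rw [Dicolor.sum_countTournaments_fixed Dicolor.IsCritical.smul,
      Dicolor.countTournaments_isCritical, Dicolor.counts_three.2, Dicolor.counts_three_three.2,
      Dicolor.counts_five.2, Dicolor.counts_five_three.2, Dicolor.counts_seven.2, h8] at h
    simp only [Dicolor.isCritical_iff]
    exact Nat.eq_of_mul_eq_mul_right (by norm_num : 0 < 40320) (h.trans (by norm_num))
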